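/- Corollary 2.4 (Entire spectrum). For $x,y\in\mathbb R$ let $\Delta(x,y)=|\operatorname{Arg} e^{\imath(x-y)}|\in[0,\pi]$ be the wrap-around distance. For distinct nodes $\mathbf x=\{x_1,\dots,x_n\}\subset(-\pi,\pi]$ and an integer $N\ge n-1$, let $\mathbf V_N(\mathbf x)=\bigl[e^{\imath k x_i}\bigr]_{k=0,\dots,N}^{i=1,\dots,n}$ be the $(N+1)\times n$ Vandermonde matrix with nodes $e^{\imath x_i}$, and let $\sigma_1\ge\dots\ge\sigma_n$ be its singular values, listed with multiplicity. Let $s^{(1)},\dots,s^{(M)}\ge1$ be integers and $\tau^{(1)},\dots,\tau^{(M)}>0$ real numbers. For $j=1,\dots,\max_k s^{(k)}$ put $\ell_j:=\#\{1\le k\le M:\ j\le s^{(k)}\}$. Then there exist constants $C_1,C_2,c,C>0$, depending only on $(s^{(k)},\tau^{(k)})_{k=1}^M$, such that the following holds for all $h$, all $\theta>0$, all $\mathbf x$ and all integers $N\ge n-1$ with $N\theta\ge C_1$ and $Nh\le C_2$. Suppose that the nodes $\mathbf x$ can be partitioned into clusters $\mathcal C^{(1)},\dots,\mathcal C^{(M)}$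 such that $\#\mathcal C^{(k)}=s^{(k)}$ for every $k$, such that $\tau^{(k)}h\le\Delta(x,y)\le h$ for all $k$ and all distinct $x,y\in\mathcal C^{(k)}$, and such that $\Delta(x,y)\ge\theta$ whenever $x$ and $y$ belong to different clusters. Then for each $j=1,\dots,\max_k s^{(k)}$ there are precisely $\ell_j$ indices $i\in\{1,\dots,n\}$ with $$c\,N^{1/2}(Nh)^{j-1}\ \le\ \sigma_i\ \le\ C\,N^{1/2}(Nh)^{j-1},$$ and every $\sigma_i$ satisfies this for exactly one such $j$. -/

import Mathlib

noncomputable section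

/-- The wrap-around distance `Δ(x, y) = |Arg exp(i (x - y))| ∈ [0, π]`. -/
def wrapDist (x y : ℝ) : ℝ :=
  |Complex.arg (Complex.exp (Complex.I * ((x - y : ℝ) : ℂ)))|

/-- The `(N + 1) × s` Vandermonde matrix with nodes `exp(i x_j)`: its entry in row
`k = 0, …, N` and column `j` is `exp(i x_j) ^ k`. -/
def vandermondeMat {ι : Type*} (N : ℕ) (x : ι → ℝ) : Matrix (Fin (N + 1)) ι ℂ :=
  Matrix.of fun k j => Complex.exp (Complex.I * (x j : ℂ)) ^ (k : ℕ)

/-- The singular values of `V_N(x)`, for nodes `x_1, …, x_n`, in non-increasing order and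
repeated according to multiplicity (the index `i : Fin n` starts at `0`). When `n ≤ N + 1`,
as is assumed throughout, there are `min (N + 1) n = n` of them. -/
def vandermondeSingularValue {n : ℕ} (N : ℕ) (x : Fin n → ℝ) (i : Fin n) : ℝ :=
  (Matrix.toEuclideanLin (vandermondeMat N x)).singularValues (i : ℕ)

/-- The family of nodes `x` forms an `(h, τ, s)`-cluster: there are `s` nodes, and the
wrap-around distance of any two different ones lies in `[τ h, h]`. -/
structure IsUniformCluster {ι : Type*} [Fintype ι] (h τ : ℝ) (s : ℕ) (x : ι → ℝ) : Prop where
  card_eq : Fintype.card ι = s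
  tau_pos : 0 < τ
  le_dist : ∀ i j, i ≠ j → τ * h ≤ wrapDist (x i) (x j)
  dist_le : ∀ i j, i ≠ j → wrapDist (x i) (x j) ≤ h

/-- The distinct nodes `x_1, …, x_n ∈ (-π, π]` form an
`((h⁽ᵏ⁾, τ⁽ᵏ⁾, s⁽ᵏ⁾)_{k = 1, …, M}, θ)`-clustered configuration. The partition of the nodes into
`M` clusters is given by the map `κ` sending (the index of) a node to (the index of) its
cluster. -/
structure IsClusteredConfig {M n : ℕ} (h τ : Fin M → ℝ) (s : Fin M → ℕ) (θ : ℝ)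
    (x : Fin n → ℝ) : Prop where
  injective : Function.Injective x
  mem_Ioc : ∀ i, x i ∈ Set.Ioc (-Real.pi) Real.pi
  theta_pos : 0 < θ
  exists_partition : ∃ κ : Fin n → Fin M,
    (∀ k, IsUniformCluster (h k) (τ k) (s k) (fun i : {i : Fin n // κ i = k} => x i)) ∧
    (∀ i j, κ i ≠ κ j → θ ≤ wrapDist (x i) (x j))

/-- `ℓ_j = #{k : j ≤ s⁽ᵏ⁾}`, the number of clusters of multiplicity at least `j`. -/
def numClustersGE {M : ℕ} (s : Fin M → ℕ) (j : ℕ) : ℕ :=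
  (Finset.univ.filter fun k : Fin M => j ≤ s k).card

/-- `c N^{1/2} (N h)^{j-1} ≤ σ ≤ C N^{1/2} (N h)^{j-1}`, for a level `j ≥ 1`. -/
def ScalesAtLevel (c C : ℝ) (N : ℕ) (h : ℝ) (j : ℕ) (σ : ℝ) : Prop :=
  c * (Real.sqrt N * (N * h) ^ (j - 1)) ≤ σ ∧ σ ≤ C * (Real.sqrt N * (N * h) ^ (j - 1))

end

/-! Put L(r) = ∑ min (s k) r. The indices i (from 0) with L(j-1) ≤ i < L(j) form the j-th block, of
size ℓ_j, and the min-max principle pins σ_i on it to order √N (Nh)^(j-1).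

Lower bound (`le_norm_vandermonde_apply`): take at most j nodes from each cluster, L(j) in all. In
an exponential sum over these nodes, one coefficient is isolated by applying filters `S ^ m - z ^
m`, S being the shift, each of which kills one other node. Killing a node of another cluster costs
no more than a constant; killing one of the at most j-1 companions in the same cluster costs a
factor of order Nh. The filters are short enough to leave a number of samples comparable to N,
whence √N.

Upper bound (`vandermondeSingularValue_le`): L(j-1) linear conditions make the coefficients vanish
on clusters with fewer than j nodes, and their first j-1 moments vanish on the others. The Taylor
expansion of every row then starts at order j-1.

For small Nh the windows of different levels are disjoint (`ScalesAtLevel.level_le`), so each window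
captures exactly its own block. -/

open Module

/-! ### Min-max bounds for singular values -/

section MinMax

variable {𝕜 E F G : Type*} [RCLike 𝕜] [NormedAddCommGroup E] [InnerProductSpace 𝕜 E]
  [FiniteDimensional 𝕜 E] [NormedAddCommGroup F] [InnerProductSpace 𝕜 F] [FiniteDimensional 𝕜 F]
  [AddCommGroup G] [Module 𝕜 G] [FiniteDimensional 𝕜 G]

/-- The squared norm of `T v` in terms of a basis of right singular vectors. -/
theorem norm_sq_apply_eq_sum_singularValues (T : E →ₗ[𝕜] F) {n : ℕ} (hn : finrank 𝕜 E = n)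
    (v : E) :
    ‖T v‖ ^ 2 = ∑ i : Fin n, T.singularValues i ^ 2 *
      ‖inner 𝕜 (T.isSymmetric_adjoint_comp_self.eigenvectorBasis hn i) v‖ ^ 2 := by
  set hT := T.isSymmetric_adjoint_comp_self
  set b := hT.eigenvectorBasis hn
  have h1 : inner 𝕜 (T v) (T v) = inner 𝕜 ((LinearMap.adjoint T ∘ₗ T) v) v := by
    simp [LinearMap.adjoint_inner_left]
  have h2 : inner 𝕜 (T v) (T v) = ((∑ i : Fin n, T.singularValues i ^ 2 *
      ‖inner 𝕜 (b i) v‖ ^ 2 : ℝ) : 𝕜) := by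
    rw [h1, ← b.sum_inner_mul_inner]
    simp only [RCLike.ofReal_sum, RCLike.ofReal_mul, RCLike.ofReal_pow]
    refine Finset.sum_congr rfl fun i _ => ?_
    rw [hT v (b i), hT.apply_eigenvectorBasis hn i, inner_smul_right, mul_assoc,
      ← inner_conj_symm v, RCLike.conj_mul, ← T.sq_singularValues_fin hn i, RCLike.ofReal_pow]
  rw [inner_self_eq_norm_sq_to_K] at h2
  exact_mod_cast h2

/-- The range of `A` has dimension above i, so it meets the orthogonal complement of the first i
right singular vectors, where `T` stretches by at most σ_i. -/
theorem le_singularValues_of_injective (T : E →ₗ[𝕜] F) (A : G →ₗ[𝕜] E)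
    (hA : Function.Injective A) {i : ℕ} (hi : i < finrank 𝕜 G) {c : ℝ}
    (hc : ∀ v, c * ‖A v‖ ≤ ‖T (A v)‖) : c ≤ T.singularValues i := by
  set n := finrank 𝕜 E with hn
  set b := T.isSymmetric_adjoint_comp_self.eigenvectorBasis hn.symm with hb
  by_contra! hlt
  have hσ := T.singularValues_nonneg i
  -- Injectivity of `A` gives i < n, so the default 0 never occurs.
  let B : G →ₗ[𝕜] (Fin i → 𝕜) := LinearMap.pi fun j =>
    if hj : (j : ℕ) < n then (innerₛₗ 𝕜 (b ⟨j, hj⟩)) ∘ₗ A else 0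
  have hker : LinearMap.ker B ≠ ⊥ := LinearMap.ker_ne_bot_of_finrank_lt (by simpa using hi)
  obtain ⟨v, hv, hv0⟩ := (Submodule.ne_bot_iff _).1 hker
  have hAv : 0 < ‖A v‖ := norm_pos_iff.2 fun h => hv0 (hA (by simpa using h))
  have hle : ‖T (A v)‖ ^ 2 ≤ T.singularValues i ^ 2 * ‖A v‖ ^ 2 := by
    rw [norm_sq_apply_eq_sum_singularValues T hn.symm, ← b.sum_sq_norm_inner_right (A v),
      Finset.mul_sum]
    refine Finset.sum_le_sum fun j _ => ?_
    by_cases hji : (j : ℕ) < i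
    · have : inner 𝕜 (b j) (A v) = 0 := by
        have := congrFun (LinearMap.mem_ker.1 hv) ⟨j, hji⟩
        simpa [B] using this
      rw [← hb, this]; simp
    · gcongr
      · exact T.singularValues_nonneg j
      · exact T.singularValues_antitone (not_lt.1 hji)
  rw [← mul_pow] at hle
  have := le_of_sq_le_sq hle (by positivity)
  have h3 := (hc v).trans this
  exact absurd (le_of_mul_le_mul_right h3 hAv) (not_le.2 hlt)

/-- The kernel of `A` has codimension at most i, so it meets the span of the first i + 1 right
singular vectors, where `T` stretches by at least σ_i. -/
theorem singularValues_le_of_forall_ker (T : E →ₗ[𝕜] F) (A : E →ₗ[𝕜] G) {i : ℕ}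
    (hin : i < finrank 𝕜 E) (hi : finrank 𝕜 G ≤ i) {C : ℝ}
    (hC : ∀ v, A v = 0 → ‖T v‖ ≤ C * ‖v‖) : T.singularValues i ≤ C := by
  set n := finrank 𝕜 E with hn
  set b := T.isSymmetric_adjoint_comp_self.eigenvectorBasis hn.symm with hb
  have hσ := T.singularValues_nonneg i
  let B : E →ₗ[𝕜] G × (Fin (n - (i + 1)) → 𝕜) := A.prod (LinearMap.pi fun j =>
    innerₛₗ 𝕜 (b ⟨i + 1 + j, by omega⟩))
  have hker : LinearMap.ker B ≠ ⊥ := LinearMap.ker_ne_bot_of_finrank_lt (by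
    rw [Module.finrank_prod, Module.finrank_fin_fun]; omega)
  obtain ⟨v, hv, hv0⟩ := (Submodule.ne_bot_iff _).1 hker
  have hBv := Prod.ext_iff.1 (LinearMap.mem_ker.1 hv)
  have hv' : 0 < ‖v‖ := norm_pos_iff.2 hv0
  have hle : T.singularValues i ^ 2 * ‖v‖ ^ 2 ≤ ‖T v‖ ^ 2 := by
    rw [norm_sq_apply_eq_sum_singularValues T hn.symm, ← b.sum_sq_norm_inner_right v,
      Finset.mul_sum]
    refine Finset.sum_le_sum fun j _ => ?_
    by_cases hji : i < (j : ℕ)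
    · have : inner 𝕜 (b j) v = 0 := by
        have := congrFun hBv.2 ⟨j - (i + 1), by omega⟩
        have hj : (⟨i + 1 + (j - (i + 1)), by omega⟩ : Fin n) = j := by ext; simp; omega
        simpa [B, hj] using this
      rw [← hb, this]; simp
    · gcongr
      exact T.singularValues_antitone (not_lt.1 hji)
  rw [← mul_pow] at hle
  have := le_of_sq_le_sq hle (by positivity)
  exact le_of_mul_le_mul_right (this.trans (hC v hBv.1)) hv'

end MinMax

/-! ### Annihilating filters for exponential sums -/

section Filter

/-- Applying the filters `S ^ m t - z t ^ m t` for `t ∈ T` to the exponential sum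
`∑ l, a l * z l ^ k` multiplies its `ℓ²` norm by at most `2 ^ #T`. -/
theorem sum_norm_sq_filtered_le {ι : Type*} [DecidableEq ι] (S : Finset ι) (z : ι → ℂ)
    (hz : ∀ l, ‖z l‖ = 1) (m : ι → ℕ) (a : ι → ℂ) (T : Finset ι) (K : ℕ) :
    ∑ k ∈ Finset.range K,
        ‖∑ l ∈ S, a l * (∏ t ∈ T, (z l ^ m t - z t ^ m t)) * z l ^ k‖ ^ 2 ≤
      4 ^ T.card * ∑ k ∈ Finset.range (K + ∑ t ∈ T, m t), ‖∑ l ∈ S, a l * z l ^ k‖ ^ 2 := by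
  induction T using Finset.induction_on generalizing K with
  | empty => simp
  | insert t T ht ih =>
    set v : ℕ → ℂ := fun k => ∑ l ∈ S, a l * (∏ t ∈ T, (z l ^ m t - z t ^ m t)) * z l ^ k
      with hv
    have hstep : ∀ k, ∑ l ∈ S, a l * (∏ t ∈ insert t T, (z l ^ m t - z t ^ m t)) * z l ^ k =
        v (k + m t) - z t ^ m t * v k := by
      intro k
      rw [hv]
      simp only [Finset.mul_sum]
      rw [← Finset.sum_sub_distrib]
      refine Finset.sum_congr rfl fun l _ => ?_
      rw [Finset.prod_insert ht, pow_add]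
      ring
    have hnorm : ∀ k, ‖v (k + m t) - z t ^ m t * v k‖ ^ 2 ≤
        2 * ‖v (k + m t)‖ ^ 2 + 2 * ‖v k‖ ^ 2 := by
      intro k
      have h1 := norm_sub_le (v (k + m t)) (z t ^ m t * v k)
      rw [norm_mul, norm_pow, hz, one_pow, one_mul] at h1
      have h2 := pow_le_pow_left₀ (norm_nonneg _) h1 2
      nlinarith [sq_nonneg (‖v (k + m t)‖ - ‖v k‖)]
    have hshift : ∑ k ∈ Finset.range K, ‖v (k + m t)‖ ^ 2 ≤
        ∑ k ∈ Finset.range (K + m t), ‖v k‖ ^ 2 := by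
      rw [add_comm K, Finset.sum_range_add]
      simp only [add_comm (m t)]
      exact le_add_of_nonneg_left (Finset.sum_nonneg fun _ _ => by positivity)
    have hmono : ∑ k ∈ Finset.range K, ‖v k‖ ^ 2 ≤
        ∑ k ∈ Finset.range (K + m t), ‖v k‖ ^ 2 :=
      Finset.sum_le_sum_of_subset_of_nonneg (Finset.range_mono (by omega))
        fun _ _ _ => by positivity
    have hih := ih (K + m t)
    rw [Finset.card_insert_of_notMem ht, Finset.sum_insert ht, ← add_assoc, pow_succ]
    calc _ = ∑ k ∈ Finset.range K, ‖v (k + m t) - z t ^ m t * v k‖ ^ 2 :=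
          Finset.sum_congr rfl fun k _ => by rw [hstep]
      _ ≤ ∑ k ∈ Finset.range K, (2 * ‖v (k + m t)‖ ^ 2 + 2 * ‖v k‖ ^ 2) :=
          Finset.sum_le_sum fun k _ => hnorm k
      _ ≤ 4 * ∑ k ∈ Finset.range (K + m t), ‖v k‖ ^ 2 := by
          rw [Finset.sum_add_distrib, ← Finset.mul_sum, ← Finset.mul_sum]
          linarith
      _ ≤ _ := by linarith

/-- A single coefficient of an exponential sum is controlled by the `ℓ²` norm of the sum. -/
theorem mul_norm_sq_mul_prod_le {ι : Type*} [DecidableEq ι] (S : Finset ι) (z : ι → ℂ)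
    (hz : ∀ l, ‖z l‖ = 1) (m : ι → ℕ) (a : ι → ℂ) {i : ι} (hi : i ∈ S) (K : ℕ) :
    K * (‖a i‖ * ∏ t ∈ S.erase i, ‖z i ^ m t - z t ^ m t‖) ^ 2 ≤
      4 ^ (S.erase i).card *
        ∑ k ∈ Finset.range (K + ∑ t ∈ S.erase i, m t), ‖∑ l ∈ S, a l * z l ^ k‖ ^ 2 := by
  refine le_trans (le_of_eq ?_) (sum_norm_sq_filtered_le S z hz m a (S.erase i) K)
  -- Only the node `i` survives the filters, so every filtered sample has the same modulus.
  rw [Finset.sum_congr rfl (g := fun _ =>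
    (‖a i‖ * ∏ t ∈ S.erase i, ‖z i ^ m t - z t ^ m t‖) ^ 2), Finset.sum_const,
    Finset.card_range, nsmul_eq_mul]
  intro k _
  rw [Finset.sum_eq_single_of_mem i hi]
  · rw [norm_mul, norm_mul, norm_pow, hz, one_pow, mul_one, norm_prod]
  · intro l hl hli
    rw [Finset.prod_eq_zero (Finset.mem_erase.2 ⟨hli, hl⟩) (sub_self _)]
    ring

end Filter

/-! ### Wrap-around distance and chords -/

section WrapDist

theorem wrapDist_le_pi (x y : ℝ) : wrapDist x y ≤ Real.pi := Complex.abs_arg_le_pi _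

theorem wrapDist_nonneg (x y : ℝ) : 0 ≤ wrapDist x y := abs_nonneg _

/-- The representative of `x - y` modulo `2π` in `(-π, π]`. -/
noncomputable def wrapDiff (x y : ℝ) : ℝ := Complex.arg (Complex.exp (Complex.I * ((x - y : ℝ) : ℂ)))

theorem abs_wrapDiff (x y : ℝ) : |wrapDiff x y| = wrapDist x y := rfl

theorem exp_mul_exp_wrapDiff (x y : ℝ) :
    Complex.exp (Complex.I * y) * Complex.exp (Complex.I * wrapDiff x y) =
      Complex.exp (Complex.I * x) := by
  have h := Complex.norm_mul_exp_arg_mul_I (Complex.exp (Complex.I * ((x - y : ℝ) : ℂ)))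
  rw [Complex.norm_exp_I_mul_ofReal, Complex.ofReal_one, one_mul, mul_comm _ Complex.I] at h
  rw [wrapDiff, h, ← Complex.exp_add]
  push_cast
  ring_nf

/-- The chord has length 2 |sin(φ/2)| with |φ| = m Δ(x, y) ≤ π, and Jordan's inequality applies to
φ/2. -/
theorem le_norm_exp_pow_sub_exp_pow (x y : ℝ) (m : ℕ) (hm : m * wrapDist x y ≤ Real.pi) :
    2 / Real.pi * (m * wrapDist x y) ≤
      ‖Complex.exp (Complex.I * x) ^ m - Complex.exp (Complex.I * y) ^ m‖ := by
  have hd : |(m * wrapDiff x y) / 2| = m * wrapDist x y / 2 := by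
    rw [abs_div, abs_mul, abs_wrapDiff, Nat.abs_cast, abs_two]
  have h := Real.mul_abs_le_abs_sin (x := (m * wrapDiff x y) / 2) (by rw [hd]; linarith)
  have he : Complex.exp (Complex.I * x) ^ m - Complex.exp (Complex.I * y) ^ m =
      Complex.exp (Complex.I * y) ^ m *
        (Complex.exp (Complex.I * (m * wrapDiff x y : ℝ)) - 1) := by
    rw [← exp_mul_exp_wrapDiff x y, mul_pow, ← Complex.exp_nat_mul _ m,
      ← Complex.exp_nat_mul _ m, mul_sub, mul_one]
    push_cast
    ring_nf
  rw [he, norm_mul, norm_pow, Complex.norm_exp_I_mul_ofReal, one_pow, one_mul,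
    Complex.norm_exp_I_mul_ofReal_sub_one, norm_mul, Real.norm_eq_abs, Real.norm_eq_abs, abs_two]
  rw [hd] at h
  linarith

/-- The largest m with m Δ ≤ π is at least 1, hence m Δ ≥ π/2 and the chord is at least 1. -/
theorem one_le_norm_exp_pow_floor_sub (x y : ℝ) (hxy : 0 < wrapDist x y) :
    1 ≤ ‖Complex.exp (Complex.I * x) ^ ⌊Real.pi / wrapDist x y⌋₊ -
      Complex.exp (Complex.I * y) ^ ⌊Real.pi / wrapDist x y⌋₊‖ := by
  have hpi := Real.pi_pos
  set m := ⌊Real.pi / wrapDist x y⌋₊ with hm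
  have h1 : (m : ℝ) * wrapDist x y ≤ Real.pi :=
    (le_div_iff₀ hxy).1 (Nat.floor_le (by positivity))
  have h2 : Real.pi < (m + 1) * wrapDist x y := (div_lt_iff₀ hxy).1 (Nat.lt_floor_add_one _)
  have h3 : 1 ≤ m := Nat.le_floor (by
    rw [le_div_iff₀ hxy, Nat.cast_one, one_mul]; exact wrapDist_le_pi x y)
  have h3' : (1 : ℝ) ≤ m := by exact_mod_cast h3
  have h4 : Real.pi / 2 ≤ m * wrapDist x y := by nlinarith
  refine le_trans ?_ (le_norm_exp_pow_sub_exp_pow x y m h1)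
  rw [div_mul_eq_mul_div, le_div_iff₀ hpi]
  linarith

end WrapDist

/-! ### Lower bound for the singular values -/

section LowerBound

/-- Filter lengths `m l` that annihilate the nodes `x l`, `l ≠ i`, without damping `x i` much, and
that leave a number `K` of samples comparable to `N`. -/
theorem exists_filter_lengths {β : Type*} {n P N : ℕ} (x : Fin n → ℝ) (κ : Fin n → β)
    {h θ τ₀ : ℝ} (hnP : n ≤ P) (hN : 1 ≤ N) (hnN : n ≤ N + 1) (hτ₀ : 0 < τ₀) (hh : 0 < h)
    (hNh : N * h ≤ 1) (hθ : 0 < θ) (hNθ : 4 * Real.pi * P ≤ N * θ)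
    (hlow : ∀ i j, i ≠ j → κ i = κ j → τ₀ * h ≤ wrapDist (x i) (x j))
    (hupp : ∀ i j, i ≠ j → κ i = κ j → wrapDist (x i) (x j) ≤ h)
    (hsep : ∀ i j, κ i ≠ κ j → θ ≤ wrapDist (x i) (x j)) (i : Fin n) :
    ∃ (m : Fin n → ℕ) (K : ℕ), K + ∑ l ∈ Finset.univ.erase i, m l = N + 1 ∧
      (N : ℝ) ≤ 2 * P * K ∧
      (∀ l, i ≠ l → κ i = κ l → τ₀ / (2 * Real.pi * P) * (N * h) ≤
        ‖Complex.exp (Complex.I * x i) ^ m l - Complex.exp (Complex.I * x l) ^ m l‖) ∧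
      (∀ l, κ i ≠ κ l → 1 ≤
        ‖Complex.exp (Complex.I * x i) ^ m l - Complex.exp (Complex.I * x l) ^ m l‖) := by
  classical
  have hpi := Real.pi_pos
  have hP : 1 ≤ P := le_trans (Nat.one_le_of_lt i.pos) hnP
  have hP' : (1 : ℝ) ≤ P := by exact_mod_cast hP
  have hN' : (1 : ℝ) ≤ N := by exact_mod_cast hN
  have hcard : (Finset.univ.erase i).card = n - 1 := by simp
  have hn := i.pos
  have hnP' : (n : ℝ) ≤ P := by exact_mod_cast hnP
  have hsame : ∀ (μ : ℕ) (l : Fin n), (N : ℝ) ≤ 4 * P * μ → μ ≤ N → i ≠ l → κ i = κ l →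
      τ₀ / (2 * Real.pi * P) * (N * h) ≤
        ‖Complex.exp (Complex.I * x i) ^ μ - Complex.exp (Complex.I * x l) ^ μ‖ := by
    intro μ l hμ hμN hil hκ
    have h1 := hlow i l hil hκ
    have h2 := hupp i l hil hκ
    have hμN' : (μ : ℝ) ≤ N := by exact_mod_cast hμN
    have h3 : (μ : ℝ) * wrapDist (x i) (x l) ≤ N * h :=
      mul_le_mul hμN' h2 (wrapDist_nonneg _ _) (by positivity)
    refine le_trans ?_ (le_norm_exp_pow_sub_exp_pow (x i) (x l) μ (by
      linarith [Real.pi_gt_three]))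
    calc τ₀ / (2 * Real.pi * P) * (N * h) ≤ τ₀ / (2 * Real.pi * P) * (4 * P * μ * h) := by gcongr
      _ = 2 / Real.pi * (μ * (τ₀ * h)) := by field_simp; ring
      _ ≤ _ := by gcongr
  by_cases hNP : 2 * P ≤ N
  -- Each filter has length at most N/(2P), and there are at most P of them, so at least half of the
  -- samples remain. For other clusters the length is at most π/θ, which is small enough because Nθ
  -- ≥ 4πP.
  · set μ := N / (2 * P) with hμ
    have hμ1 : 1 ≤ μ := (Nat.one_le_div_iff (by omega)).2 hNP
    have hμ2 : 2 * P * μ ≤ N := Nat.mul_div_le _ _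
    have hμ3 : N < 2 * P * μ + 2 * P := by
      have := Nat.lt_mul_div_succ N (show 0 < 2 * P by omega)
      rw [← hμ] at this; linarith
    have hμ4 : N ≤ 4 * P * μ := by nlinarith
    set m : Fin n → ℕ := fun l =>
      if κ i = κ l then μ else ⌊Real.pi / wrapDist (x i) (x l)⌋₊ with hm
    have hmle : ∀ l, 2 * P * m l ≤ N := by
      intro l
      rw [hm]
      dsimp only
      split_ifs with hκ
      · exact hμ2
      · have hd := hsep i l hκ
        have hd0 : 0 < wrapDist (x i) (x l) := hθ.trans_le hd
        have h1 : (⌊Real.pi / wrapDist (x i) (x l)⌋₊ : ℝ) * wrapDist (x i) (x l) ≤ Real.pi :=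
          (le_div_iff₀ hd0).1 (Nat.floor_le (by positivity))
        have h2 : (⌊Real.pi / wrapDist (x i) (x l)⌋₊ : ℝ) * θ ≤ Real.pi :=
          le_trans (by gcongr) h1
        have h3 : (2 * P * ⌊Real.pi / wrapDist (x i) (x l)⌋₊ : ℝ) ≤ N := by
          refine le_of_mul_le_mul_right ?_ hθ
          nlinarith
        exact_mod_cast h3
    have hsum : 2 * ∑ l ∈ Finset.univ.erase i, m l ≤ N := by
      have h1 : P * (2 * ∑ l ∈ Finset.univ.erase i, m l) ≤ P * N := by
        calc P * (2 * ∑ l ∈ Finset.univ.erase i, m l)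
            = ∑ l ∈ Finset.univ.erase i, 2 * P * m l := by rw [← Finset.mul_sum]; ring
          _ ≤ ∑ l ∈ Finset.univ.erase i, N := Finset.sum_le_sum fun l _ => hmle l
          _ = (n - 1) * N := by rw [Finset.sum_const, hcard, smul_eq_mul]
          _ ≤ P * N := Nat.mul_le_mul_right _ (by omega)
      exact Nat.le_of_mul_le_mul_left h1 (by omega)
    refine ⟨m, N + 1 - ∑ l ∈ Finset.univ.erase i, m l, by omega, ?_, ?_, ?_⟩
    · have h1 : N ≤ 2 * (N + 1 - ∑ l ∈ Finset.univ.erase i, m l) := by omega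
      have h2 : N ≤ 2 * P * (N + 1 - ∑ l ∈ Finset.univ.erase i, m l) := by nlinarith
      exact_mod_cast h2
    · intro l hil hκ
      rw [hm]
      simp only [hκ, if_true]
      exact hsame μ l (by exact_mod_cast hμ4) (by nlinarith) hil hκ
    · intro l hκ
      rw [hm]
      simp only [hκ, if_false]
      exact one_le_norm_exp_pow_floor_sub _ _ (hθ.trans_le (hsep i l hκ))
  -- For N < 2P filters of length 1 suffice: at least one sample remains, and one sample is already
  -- comparable to N.
  · refine ⟨fun _ => 1, N + 1 - (n - 1), ?_, ?_, ?_, ?_⟩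
    · rw [Finset.sum_const, hcard, smul_eq_mul]; omega
    · have h1 : 1 ≤ N + 1 - (n - 1) := by omega
      have h2 : N ≤ 2 * P * (N + 1 - (n - 1)) := by nlinarith
      exact_mod_cast h2
    · intro l hil hκ
      have h2 : N ≤ 4 * P * 1 := by omega
      exact hsame 1 l (by exact_mod_cast h2) hN hil hκ
    -- There is no second cluster here: θ ≤ π and N < 2P contradict Nθ ≥ 4πP.
    · intro l hκ
      have h1 := (hsep i l hκ).trans (wrapDist_le_pi _ _)
      have h2 : (N : ℝ) < 2 * P := by exact_mod_cast not_le.1 hNP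
      nlinarith

theorem norm_sq_vandermonde_apply {n N : ℕ} (x : Fin n → ℝ) (v : EuclideanSpace ℂ (Fin n)) :
    ‖Matrix.toEuclideanLin (vandermondeMat N x) v‖ ^ 2 =
      ∑ k ∈ Finset.range (N + 1), ‖∑ l, v l * Complex.exp (Complex.I * x l) ^ k‖ ^ 2 := by
  rw [EuclideanSpace.norm_sq_eq, Finset.sum_range]
  refine Finset.sum_congr rfl fun k _ => ?_
  simp [Matrix.mulVec, dotProduct, vandermondeMat, mul_comm]

/-- Lower bound for the Vandermonde matrix on vectors supported on a set `S` of nodes that meets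
every cluster in at most `r + 1` nodes. -/
theorem le_norm_vandermonde_apply {β : Type*} [DecidableEq β] {n P N r : ℕ} (x : Fin n → ℝ)
    (κ : Fin n → β) {h θ τ₀ : ℝ} (hnP : n ≤ P) (hN : 1 ≤ N) (hnN : n ≤ N + 1) (hτ₀ : 0 < τ₀)
    (hτ₁ : τ₀ ≤ 1) (hh : 0 < h) (hNh : N * h ≤ 1) (hθ : 0 < θ)
    (hNθ : 4 * Real.pi * P ≤ N * θ)
    (hlow : ∀ i j, i ≠ j → κ i = κ j → τ₀ * h ≤ wrapDist (x i) (x j))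
    (hupp : ∀ i j, i ≠ j → κ i = κ j → wrapDist (x i) (x j) ≤ h)
    (hsep : ∀ i j, κ i ≠ κ j → θ ≤ wrapDist (x i) (x j)) (S : Finset (Fin n))
    (hS : ∀ k, (S.filter fun i => κ i = k).card ≤ r + 1) (v : EuclideanSpace ℂ (Fin n))
    (hv : ∀ i ∉ S, v i = 0) :
    Real.sqrt N * (τ₀ / (2 * Real.pi * P) * (N * h)) ^ r * ‖v‖ ≤
      2 * P * 2 ^ P * ‖Matrix.toEuclideanLin (vandermondeMat N x) v‖ := by
  classical
  have hpi := Real.pi_pos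
  set q := τ₀ / (2 * Real.pi * P) * (N * h) with hq
  set z : Fin n → ℂ := fun l => Complex.exp (Complex.I * x l) with hz
  have hz1 : ∀ l, ‖z l‖ = 1 := fun l => Complex.norm_exp_I_mul_ofReal _
  set R := ‖Matrix.toEuclideanLin (vandermondeMat N x) v‖ with hR
  have hRsum : R ^ 2 = ∑ k ∈ Finset.range (N + 1), ‖∑ l ∈ S, v l * z l ^ k‖ ^ 2 := by
    rw [hR, norm_sq_vandermonde_apply]
    refine Finset.sum_congr rfl fun k _ => ?_
    rw [← Finset.sum_subset (Finset.subset_univ S)]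
    intro l _ hl
    rw [hv l hl, zero_mul]
  have hq0 : 0 ≤ q := by positivity
  have hcoef : ∀ i, N * (q ^ r * ‖v i‖) ^ 2 ≤ 2 * P * 4 ^ P * R ^ 2 := by
    intro i
    by_cases hi : i ∈ S
    swap
    · rw [hv i hi]; simp only [norm_zero, mul_zero]
      norm_num
      positivity
    have hP : (1 : ℝ) ≤ P := by exact_mod_cast le_trans (Nat.one_le_of_lt i.pos) hnP
    have hq1 : q ≤ 1 := by
      rw [hq]
      refine mul_le_one₀ ((div_le_one (by positivity)).2 ?_) (by positivity) hNh
      nlinarith [Real.pi_gt_three]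
    obtain ⟨m, K, hK, hNK, hsame, hdiff⟩ :=
      exists_filter_lengths x κ hnP hN hnN hτ₀ hh hNh hθ hNθ hlow hupp hsep i
    have hprod : q ^ r ≤ ∏ t ∈ S.erase i, ‖z i ^ m t - z t ^ m t‖ := by
      have hcard : ((S.erase i).filter fun t => κ i = κ t).card ≤ r := by
        have h1 := hS (κ i)
        have h2 : ((S.erase i).filter fun t => κ i = κ t) =
            (S.filter fun t => κ t = κ i).erase i := by
          ext t; simp only [Finset.mem_filter, Finset.mem_erase]; tauto
        rw [h2, Finset.card_erase_of_mem (by simp [hi])]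
        omega
      calc q ^ r ≤ q ^ ((S.erase i).filter fun t => κ i = κ t).card :=
            pow_le_pow_of_le_one hq0 hq1 hcard
        _ = ∏ t ∈ S.erase i, if κ i = κ t then q else 1 := by
            rw [← Finset.prod_filter, Finset.prod_const]
        _ ≤ _ := by
            refine Finset.prod_le_prod (fun t _ => by split_ifs <;> positivity) fun t ht => ?_
            split_ifs with hκ
            · exact hsame t (Finset.ne_of_mem_erase ht).symm hκ
            · exact hdiff t hκ
    have hmain := mul_norm_sq_mul_prod_le S z hz1 m v hi K
    have hrange : ∑ k ∈ Finset.range (K + ∑ t ∈ S.erase i, m t), ‖∑ l ∈ S, v l * z l ^ k‖ ^ 2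
        ≤ R ^ 2 := by
      rw [hRsum]
      refine Finset.sum_le_sum_of_subset_of_nonneg (Finset.range_mono ?_)
        fun _ _ _ => by positivity
      rw [← hK]
      exact Nat.add_le_add_left (Finset.sum_le_sum_of_subset
        (Finset.erase_subset_erase i (Finset.subset_univ S))) K
    have hcardS : (S.erase i).card ≤ P :=
      ((Finset.card_le_univ _).trans (by simp)).trans hnP
    have h4 : (4 : ℝ) ^ (S.erase i).card ≤ 4 ^ P := pow_le_pow_right₀ (by norm_num) hcardS
    have hKbound : K * (q ^ r * ‖v i‖) ^ 2 ≤ 4 ^ P * R ^ 2 := by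
      calc K * (q ^ r * ‖v i‖) ^ 2
          ≤ K * (‖v i‖ * ∏ t ∈ S.erase i, ‖z i ^ m t - z t ^ m t‖) ^ 2 := by
            rw [mul_comm (q ^ r)]; gcongr
        _ ≤ _ := hmain
        _ ≤ _ := by gcongr
    calc N * (q ^ r * ‖v i‖) ^ 2 ≤ 2 * P * K * (q ^ r * ‖v i‖) ^ 2 := by gcongr
      _ = 2 * P * (K * (q ^ r * ‖v i‖) ^ 2) := by ring
      _ ≤ 2 * P * (4 ^ P * R ^ 2) := by gcongr
      _ = _ := by ring
  refine le_of_sq_le_sq ?_ (by positivity)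
  calc (Real.sqrt N * q ^ r * ‖v‖) ^ 2 = ∑ i, N * (q ^ r * ‖v i‖) ^ 2 := by
        rw [mul_pow, mul_pow, Real.sq_sqrt (by positivity), EuclideanSpace.norm_sq_eq,
          Finset.mul_sum]
        exact Finset.sum_congr rfl fun i _ => by ring
    _ ≤ ∑ i : Fin n, 2 * P * 4 ^ P * R ^ 2 := Finset.sum_le_sum fun i _ => hcoef i
    _ = n * (2 * P * 4 ^ P * R ^ 2) := by simp
    -- The factor n is weakened to 2P to obtain a perfect square.
    _ ≤ (2 * P) * (2 * P * 4 ^ P * R ^ 2) := by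
        have : (n : ℝ) ≤ P := by exact_mod_cast hnP
        gcongr
        linarith [show (0 : ℝ) ≤ P by positivity]
    _ = (2 * P * 2 ^ P * R) ^ 2 := by
        rw [show (4 : ℝ) = 2 ^ 2 by norm_num, ← pow_mul]; ring

theorem le_vandermondeSingularValue {β : Type*} [DecidableEq β] {n P N r : ℕ} (x : Fin n → ℝ)
    (κ : Fin n → β) {h θ τ₀ : ℝ} (hP : 1 ≤ P) (hnP : n ≤ P) (hrP : r ≤ P) (hN : 1 ≤ N)
    (hnN : n ≤ N + 1)
    (hτ₀ : 0 < τ₀) (hτ₁ : τ₀ ≤ 1) (hh : 0 < h) (hNh : N * h ≤ 1) (hθ : 0 < θ)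
    (hNθ : 4 * Real.pi * P ≤ N * θ)
    (hlow : ∀ i j, i ≠ j → κ i = κ j → τ₀ * h ≤ wrapDist (x i) (x j))
    (hupp : ∀ i j, i ≠ j → κ i = κ j → wrapDist (x i) (x j) ≤ h)
    (hsep : ∀ i j, κ i ≠ κ j → θ ≤ wrapDist (x i) (x j)) (S : Finset (Fin n))
    (hS : ∀ k, (S.filter fun i => κ i = k).card ≤ r + 1) (i : Fin n) (hi : (i : ℕ) < S.card) :
    (τ₀ / (2 * Real.pi * P)) ^ P / (2 * P * 2 ^ P) * (Real.sqrt N * (N * h) ^ r) ≤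
      vandermondeSingularValue N x i := by
  have hpi := Real.pi_pos
  have hP' : (1 : ℝ) ≤ P := by exact_mod_cast hP
  let A : (S → ℂ) →ₗ[ℂ] EuclideanSpace ℂ (Fin n) :=
    (WithLp.linearEquiv 2 ℂ (Fin n → ℂ)).symm.toLinearMap ∘ₗ
      Function.ExtendByZero.linearMap ℂ (Subtype.val : S → Fin n)
  have hA : ∀ (a : S → ℂ) (l : S), A a l = a l := fun a l =>
    Subtype.val_injective.extend_apply a 0 l
  have hA0 : ∀ (a : S → ℂ), ∀ l ∉ S, A a l = 0 := fun a l hl =>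
    Function.extend_apply' (f := (Subtype.val : S → Fin n)) a 0 l
      (fun ⟨t, ht⟩ => hl (ht ▸ t.2))
  refine le_singularValues_of_injective _ A ?_ (by simpa using hi) fun a => ?_
  · intro a b hab
    ext l
    rw [← hA a l, ← hA b l, hab]
  · have hq : τ₀ / (2 * Real.pi * P) ≤ 1 :=
      (div_le_one (by positivity)).2 (by nlinarith [Real.pi_gt_three])
    have h1 := le_norm_vandermonde_apply x κ hnP hN hnN hτ₀ hτ₁ hh hNh hθ hNθ hlow hupp hsep S hS
      (A a) (hA0 a)
    -- The exponent P makes the constant independent of the level.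
    have h2 : (τ₀ / (2 * Real.pi * P)) ^ P ≤ (τ₀ / (2 * Real.pi * P)) ^ r :=
      pow_le_pow_of_le_one (by positivity) hq hrP
    rw [mul_pow] at h1
    rw [div_mul_eq_mul_div, div_mul_eq_mul_div, div_le_iff₀ (by positivity), mul_comm ‖_‖]
    refine le_trans ?_ h1
    calc _ ≤ (τ₀ / (2 * Real.pi * P)) ^ r * (Real.sqrt N * (N * h) ^ r) * ‖A a‖ := by gcongr
      _ = _ := by ring

end LowerBound

/-! ### Upper bound for the singular values -/

section UpperBound

/-- The vanishing moments remove the Taylor polynomial of degree below r; the remainder is at most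
|u|^r e^|u| with |u| ≤ δ ≤ 1. -/
theorem norm_sum_mul_exp_pow_le {ι : Type*} (S : Finset ι) (a : ι → ℂ) (y : ι → ℝ) (w : ℂ)
    (hw : ‖w‖ = 1) (p r : ℕ) {δ : ℝ} (hδ : δ ≤ 1) (hy : ∀ i ∈ S, p * |y i| ≤ δ)
    (hmom : ∀ m < r, ∑ i ∈ S, a i * (y i : ℂ) ^ m = 0) :
    ‖∑ i ∈ S, a i * (w * Complex.exp (Complex.I * y i)) ^ p‖ ≤ 3 * δ ^ r * ∑ i ∈ S, ‖a i‖ := by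
  set u : ι → ℂ := fun i => Complex.I * (p * y i : ℝ) with hu
  have hun : ∀ i, ‖u i‖ = p * |y i| := by
    intro i
    rw [hu]
    simp
  have hzero : ∑ i ∈ S, a i * ∑ m ∈ Finset.range r, u i ^ m / m.factorial = 0 := by
    simp only [Finset.mul_sum]
    rw [Finset.sum_comm]
    refine Finset.sum_eq_zero fun m hm => ?_
    calc _ = (Complex.I * p) ^ m / m.factorial * ∑ i ∈ S, a i * (y i : ℂ) ^ m := by
          rw [Finset.mul_sum]
          refine Finset.sum_congr rfl fun i _ => ?_
          rw [hu]
          push_cast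
          ring
      _ = 0 := by rw [hmom m (Finset.mem_range.1 hm), mul_zero]
  have heq : ∑ i ∈ S, a i * (w * Complex.exp (Complex.I * y i)) ^ p =
      w ^ p * ∑ i ∈ S, a i *
        (Complex.exp (u i) - ∑ m ∈ Finset.range r, u i ^ m / m.factorial) := by
    simp only [mul_sub]
    rw [Finset.sum_sub_distrib, hzero, sub_zero, Finset.mul_sum]
    refine Finset.sum_congr rfl fun i _ => ?_
    rw [mul_pow, ← Complex.exp_nat_mul, hu]
    push_cast
    ring_nf
  rw [heq, norm_mul, norm_pow, hw, one_pow, one_mul, Finset.mul_sum]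
  refine (norm_sum_le _ _).trans (Finset.sum_le_sum fun i hi => ?_)
  rw [norm_mul, mul_comm]
  have h1 := Complex.norm_exp_sub_sum_le_norm_mul_exp (u i) r
  have h2 : ‖u i‖ ≤ δ := (hun i).trans_le (hy i hi)
  have h3 : Real.exp ‖u i‖ ≤ 3 :=
    (Real.exp_le_exp.2 (h2.trans hδ)).trans Real.exp_one_lt_three.le
  refine mul_le_mul_of_nonneg_right ?_ (norm_nonneg _)
  calc _ ≤ ‖u i‖ ^ r * Real.exp ‖u i‖ := h1
    _ ≤ δ ^ r * 3 := by
        gcongr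
        exact pow_nonneg ((norm_nonneg _).trans h2) r
    _ = _ := by ring

theorem vandermondeSingularValue_le {β : Type*} [Fintype β] [DecidableEq β] {n P N r : ℕ}
    (x : Fin n → ℝ) (κ : Fin n → β) (s : β → ℕ) {h : ℝ} (hnP : n ≤ P) (hN : 1 ≤ N) (hh : 0 < h)
    (hNh : N * h ≤ 1) (hs : ∀ k, Fintype.card {i : Fin n // κ i = k} = s k) (hs1 : ∀ k, 1 ≤ s k)
    (hupp : ∀ i j, i ≠ j → κ i = κ j → wrapDist (x i) (x j) ≤ h) (i : Fin n)
    (hi : ∑ k, min (s k) r ≤ i) :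
    vandermondeSingularValue N x i ≤ 6 * P * (Real.sqrt N * (N * h) ^ r) := by
  have hne : ∀ k, Nonempty {i : Fin n // κ i = k} := fun k =>
    Fintype.card_pos_iff.1 (by rw [hs]; exact hs1 k)
  let ctr : β → Fin n := fun k => (hne k).some.1
  have hctr : ∀ k, κ (ctr k) = k := fun k => (hne k).some.2
  let e : ∀ k, Fin (s k) ≃ {i : Fin n // κ i = k} := fun k =>
    (Fintype.equivFinOfCardEq (hs k)).symm
  let y : Fin n → ℝ := fun l => wrapDiff (x l) (x (ctr (κ l)))
  have hy : ∀ l, |y l| ≤ h := by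
    intro l
    by_cases hl : l = ctr (κ l)
    · have : y l = 0 := by
        change wrapDiff (x l) (x (ctr (κ l))) = 0
        rw [← hl]
        simp [wrapDiff]
      rw [this, abs_zero]; exact hh.le
    · exact hupp l _ hl (hctr _).symm
  -- The conditions: all coordinates of a cluster with at most r nodes, the moments of order below r
  -- about its chosen centre for a larger one.
  let g : (Σ k, Fin (min (s k) r)) → Fin n → ℂ := fun km l =>
    if s km.1 ≤ r then (if l = e km.1 ⟨km.2, by omega⟩ then 1 else 0)
    else (if κ l = km.1 then (y l : ℂ) ^ (km.2 : ℕ) else 0)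
  let A : EuclideanSpace ℂ (Fin n) →ₗ[ℂ] ((Σ k, Fin (min (s k) r)) → ℂ) :=
    LinearMap.pi fun km => ∑ l, g km l • EuclideanSpace.projₗ l
  have hAapp : ∀ v km, A v km = ∑ l, g km l * v l := by
    intro v km
    simp [A]
  refine singularValues_le_of_forall_ker _ A (by simp) (by simpa using hi) fun v hv => ?_
  have hvk : ∀ km, ∑ l, g km l * v l = 0 := fun km => by rw [← hAapp, hv]; rfl
  have hN' : (1 : ℝ) ≤ N := by exact_mod_cast hN
  have hcluster : ∀ k, ∀ p < N + 1, ‖∑ l with κ l = k, v l * Complex.exp (Complex.I * x l) ^ p‖ ≤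
      3 * (N * h) ^ r * ∑ l with κ l = k, ‖v l‖ := by
    intro k p hp
    by_cases hk : s k ≤ r
    · have h0 : ∀ l, κ l = k → v l = 0 := by
        intro l hl
        have hlt := ((e k).symm ⟨l, hl⟩).2
        have := hvk ⟨k, ⟨(e k).symm ⟨l, hl⟩, by omega⟩⟩
        simpa [g, hk] using this
      rw [Finset.sum_eq_zero, norm_zero]
      · positivity
      · intro l hl
        rw [h0 l (Finset.mem_filter.1 hl).2, zero_mul]
    · have hsum : ∑ l with κ l = k, v l * Complex.exp (Complex.I * x l) ^ p =
          ∑ l with κ l = k, v l *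
            (Complex.exp (Complex.I * x (ctr k)) * Complex.exp (Complex.I * y l)) ^ p := by
        refine Finset.sum_congr rfl fun l hl => ?_
        have hl' := (Finset.mem_filter.1 hl).2
        have := exp_mul_exp_wrapDiff (x l) (x (ctr (κ l)))
        rw [← this, hl']
        simp only [y, hl']
      rw [hsum]
      refine norm_sum_mul_exp_pow_le _ _ _ _ (Complex.norm_exp_I_mul_ofReal _) p r hNh ?_ ?_
      · intro l _
        have : (p : ℝ) ≤ N := by exact_mod_cast Nat.lt_succ_iff.1 hp
        exact mul_le_mul this (hy l) (abs_nonneg _) (by positivity)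
      · intro m hm
        have := hvk ⟨k, ⟨m, by omega⟩⟩
        simp only [g, hk, if_false, ite_mul, zero_mul] at this
        rw [Finset.sum_filter]
        simpa [mul_comm] using this
  have hrow : ∀ p < N + 1, ‖∑ l, v l * Complex.exp (Complex.I * x l) ^ p‖ ≤
      3 * (N * h) ^ r * (n * ‖v‖) := by
    intro p hp
    rw [← Finset.sum_fiberwise Finset.univ κ]
    calc _ ≤ ∑ k, 3 * (N * h) ^ r * ∑ l with κ l = k, ‖v l‖ :=
          (norm_sum_le _ _).trans (Finset.sum_le_sum fun k _ => hcluster k p hp)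
      _ = 3 * (N * h) ^ r * ∑ l, ‖v l‖ := by
          rw [← Finset.mul_sum, Finset.sum_fiberwise]
      _ ≤ 3 * (N * h) ^ r * ∑ _l : Fin n, ‖v‖ := by
          gcongr with l
          exact PiLp.norm_apply_le v l
      _ = _ := by simp
  refine le_of_sq_le_sq ?_ (by positivity)
  have hnP' : (n : ℝ) ≤ P := by exact_mod_cast hnP
  rw [EuclideanSpace.norm_sq_eq]
  calc _ ≤ ∑ _p : Fin (N + 1), (3 * (N * h) ^ r * (n * ‖v‖)) ^ 2 := by
        refine Finset.sum_le_sum fun p _ => ?_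
        refine pow_le_pow_left₀ (norm_nonneg _) ?_ 2
        refine le_of_eq_of_le ?_ (hrow p p.2)
        simp [Matrix.mulVec, dotProduct, vandermondeMat, mul_comm]
    _ = (N + 1) * (3 * (N * h) ^ r * (n * ‖v‖)) ^ 2 := by simp
    -- 4N rather than 2N, since 4 · 3² = 6² is a square.
    _ ≤ (4 * N) * (3 * (N * h) ^ r * (P * ‖v‖)) ^ 2 := by
        gcongr
        linarith
    _ = (6 * P * (Real.sqrt N * (N * h) ^ r) * ‖v‖) ^ 2 := by
        have := Real.sq_sqrt (show (0 : ℝ) ≤ N by positivity)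
        simp only [mul_pow, this]
        ring

end UpperBound

theorem wrapDist_pos {x y : ℝ} (hx : x ∈ Set.Ioc (-Real.pi) Real.pi)
    (hy : y ∈ Set.Ioc (-Real.pi) Real.pi) (hxy : x ≠ y) : 0 < wrapDist x y := by
  refine (wrapDist_nonneg x y).lt_of_ne' fun h => hxy ?_
  have h1 := exp_mul_exp_wrapDiff x y
  rw [abs_eq_zero.1 ((abs_wrapDiff x y).trans h), Complex.ofReal_zero, mul_zero, Complex.exp_zero,
    mul_one] at h1
  have h2 := Complex.exp_inj_of_neg_pi_lt_of_le_pi (by simpa using hy.1) (by simpa using hy.2)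
    (by simpa using hx.1) (by simpa using hx.2) h1
  simpa using h2.symm

/-! ### Block sizes and separation of levels -/

section Counting

theorem sum_min_succ {M : ℕ} (s : Fin M → ℕ) (r : ℕ) :
    ∑ k, min (s k) (r + 1) = ∑ k, min (s k) r + numClustersGE s (r + 1) := by
  rw [numClustersGE, Finset.card_filter, ← Finset.sum_add_distrib]
  refine Finset.sum_congr rfl fun k _ => ?_
  split_ifs <;> omega

theorem exists_finset_card_eq_sum_min {M n : ℕ} (s : Fin M → ℕ) (κ : Fin n → Fin M)
    (hs : ∀ k, Fintype.card {i : Fin n // κ i = k} = s k) (r : ℕ) :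
    ∃ S : Finset (Fin n), S.card = ∑ k, min (s k) r ∧
      ∀ k, (S.filter fun i => κ i = k).card ≤ r := by
  have hex : ∀ k, ∃ t ⊆ (Finset.univ.filter fun i => κ i = k), t.card = min (s k) r := by
    intro k
    refine Finset.exists_subset_card_eq ?_
    rw [← Fintype.card_subtype, hs]
    exact min_le_left _ _
  choose t ht htc using hex
  have hfib : ∀ k, ((Finset.univ.filter fun i => i ∈ t (κ i)).filter fun i => κ i = k) = t k := by
    intro k
    ext i
    simp only [Finset.mem_filter, Finset.mem_univ, true_and]
    refine ⟨fun ⟨h1, h2⟩ => h2 ▸ h1, fun h => ?_⟩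
    have := (Finset.mem_filter.1 (ht k h)).2
    exact ⟨by rwa [this], this⟩
  refine ⟨Finset.univ.filter fun i => i ∈ t (κ i), ?_, fun k => ?_⟩
  · rw [Finset.card_eq_sum_card_fiberwise (f := κ) (t := Finset.univ) (by simp)]
    exact Finset.sum_congr rfl fun k _ => by rw [hfib, htc]
  · rw [hfib, htc]; exact min_le_right _ _

/-- Going up at least one level multiplies the upper bound by at most Nh ≤ c/(2C), which puts it at
or below half of the lower bound at level j. -/
theorem ScalesAtLevel.level_le {c C h σ : ℝ} {N j j' : ℕ} (hc : 0 < c) (hcC : c ≤ C)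
    (hN : 0 < N) (hh : 0 < h) (hNh : N * h ≤ c / (2 * C)) (hj : 1 ≤ j)
    (h1 : ScalesAtLevel c C N h j σ) (h2 : ScalesAtLevel c C N h j' σ) : j' ≤ j := by
  by_contra! hlt
  have hN' : (0 : ℝ) < N := by exact_mod_cast hN
  have hC : 0 < C := hc.trans_le hcC
  have hq : (0 : ℝ) < N * h := by positivity
  have hq1 : N * h ≤ 1 := hNh.trans ((div_le_one (by positivity)).2 (by linarith))
  have h3 := h1.1.trans h2.2
  obtain ⟨d, hd⟩ : ∃ d, j' - 1 = (j - 1) + 1 + d := ⟨j' - 1 - (j - 1) - 1, by omega⟩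
  set X := Real.sqrt N * (N * h) ^ (j - 1) with hX
  have hX0 : 0 < X := by positivity
  have h4 : Real.sqrt N * (N * h) ^ (j' - 1) ≤ X * (N * h) := by
    rw [hd, pow_add, pow_succ, ← mul_assoc, ← mul_assoc, ← hX]
    exact mul_le_of_le_one_right (by positivity) (pow_le_one₀ hq.le hq1)
  have h5 : c * X ≤ c / 2 * X := by
    calc c * X ≤ C * (X * (N * h)) := h3.trans (by gcongr)
      _ ≤ C * (X * (c / (2 * C))) := by gcongr
      _ = c / 2 * X := by field_simp
  nlinarith [mul_pos hc hX0]

end Counting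

/-! ### From indices to multiplicities -/

section Spectrum

/-- If the singular values lie at the level prescribed by their index, the levels are attained with
the stated multiplicities. -/
theorem card_scalesAtLevel_of_index {M n N : ℕ} (s : Fin M → ℕ) {c C h : ℝ} (hc : 0 < c)
    (hcC : c ≤ C) (hN : 0 < N) (hh : 0 < h) (hNh : N * h ≤ c / (2 * C)) (σ : Fin n → ℝ)
    (hn : ∑ k, s k = n)
    (hσ : ∀ j ∈ Finset.Icc 1 (Finset.univ.sup s), ∀ i : Fin n, ∑ k, min (s k) (j - 1) ≤ i →
      i < ∑ k, min (s k) j → ScalesAtLevel c C N h j (σ i)) :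
    (∀ j ∈ Finset.Icc 1 (Finset.univ.sup s),
      Nat.card {i : Fin n // ScalesAtLevel c C N h j (σ i)} = numClustersGE s j) ∧
    (∀ i : Fin n, ∃! j, j ∈ Finset.Icc 1 (Finset.univ.sup s) ∧
      ScalesAtLevel c C N h j (σ i)) := by
  classical
  set L : ℕ → ℕ := fun r => ∑ k, min (s k) r with hL
  have hLn : ∀ r, L r ≤ n := fun r => hn ▸ Finset.sum_le_sum fun k _ => min_le_left _ _
  have hLtop : L (Finset.univ.sup s) = n := by
    rw [← hn]
    exact Finset.sum_congr rfl fun k _ => min_eq_left (Finset.le_sup (Finset.mem_univ k))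
  have huniq : ∀ i, ∀ j ∈ Finset.Icc 1 (Finset.univ.sup s),
      ∀ j' ∈ Finset.Icc 1 (Finset.univ.sup s), ScalesAtLevel c C N h j (σ i) →
      ScalesAtLevel c C N h j' (σ i) → j = j' := fun i j hj j' hj' h1 h2 =>
    le_antisymm (h2.level_le hc hcC hN hh hNh (Finset.mem_Icc.1 hj').1 h1)
      (h1.level_le hc hcC hN hh hNh (Finset.mem_Icc.1 hj).1 h2)
  -- Since L(0) = 0 and L(max s) = n, the blocks exhaust all indices.
  have hexists : ∀ i : Fin n, ∃ j ∈ Finset.Icc 1 (Finset.univ.sup s), L (j - 1) ≤ i ∧ i < L j := by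
    intro i
    have hex : ∃ j, (i : ℕ) < L j := ⟨_, i.2.trans_eq hLtop.symm⟩
    have h0 : Nat.find hex ≠ 0 := by
      intro h0
      have := Nat.find_spec hex
      rw [h0] at this
      simp [hL] at this
    refine ⟨Nat.find hex, Finset.mem_Icc.2 ⟨by omega, Nat.find_min' hex (i.2.trans_eq hLtop.symm)⟩,
      not_lt.1 (Nat.find_min hex (by omega)), Nat.find_spec hex⟩
  constructor
  · intro j hj
    have hiff : ∀ i : Fin n, ScalesAtLevel c C N h j (σ i) ↔ L (j - 1) ≤ i ∧ i < L j := by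
      refine fun i => ⟨fun hi => ?_, fun hi => hσ j hj i hi.1 hi.2⟩
      obtain ⟨j', hj', h1, h2⟩ := hexists i
      rwa [huniq i j hj j' hj' hi (hσ j' hj' i h1 h2), and_iff_left h2]
    have hj1 := (Finset.mem_Icc.1 hj).1
    have hsucc := sum_min_succ s (j - 1)
    rw [Nat.sub_add_cancel hj1] at hsucc
    have hcard : Nat.card {i : Fin n // ScalesAtLevel c C N h j (σ i)} =
        (Finset.Ico (L (j - 1)) (L j)).card := by
      rw [Nat.card_eq_fintype_card, Fintype.card_subtype,
        ← Finset.card_map Fin.valEmbedding]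
      congr 1
      ext a
      simp only [Finset.mem_map, Finset.mem_filter, Finset.mem_univ, true_and, hiff,
        Fin.valEmbedding_apply, Finset.mem_Ico]
      exact ⟨fun ⟨i, hi, hia⟩ => hia ▸ hi, fun ha => ⟨⟨a, ha.2.trans_le (hLn j)⟩, ha, rfl⟩⟩
    rw [hcard, Nat.card_Ico]
    exact Nat.sub_eq_of_eq_add' hsucc
  · intro i
    obtain ⟨j, hj, h1, h2⟩ := hexists i
    exact ⟨j, ⟨hj, hσ j hj i h1 h2⟩, fun j' hj' => huniq i j' hj'.1 j hj hj'.2 (hσ j hj i h1 h2)⟩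

end Spectrum

/-! ### Choice of constants and conclusion -/

theorem corollary2p4 (M : ℕ) (s : Fin M → ℕ) (hs : ∀ k, 1 ≤ s k)
    (τ : Fin M → ℝ) (hτ : ∀ k, 0 < τ k) :
    ∃ C₁ C₂ c C : ℝ, 0 < C₁ ∧ 0 < C₂ ∧ 0 < c ∧ 0 < C ∧
      ∀ (n : ℕ) (x : Fin n → ℝ) (h θ : ℝ) (N : ℕ),
        IsClusteredConfig (fun _ => h) τ s θ x →
        n ≤ N + 1 → C₁ ≤ N * θ → N * h ≤ C₂ →
          (∀ j ∈ Finset.Icc 1 (Finset.univ.sup s),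
            Nat.card {i : Fin n // ScalesAtLevel c C N h j (vandermondeSingularValue N x i)}
              = numClustersGE s j) ∧
          (∀ i : Fin n, ∃! j, j ∈ Finset.Icc 1 (Finset.univ.sup s) ∧
            ScalesAtLevel c C N h j (vandermondeSingularValue N x i)) := by
  have hpi := Real.pi_pos
  obtain ⟨τ₀, hτ₀, hτ₁, hττ⟩ : ∃ τ₀ : ℝ, 0 < τ₀ ∧ τ₀ ≤ 1 ∧ ∀ k, τ₀ ≤ τ k := by
    have hsum : 0 ≤ ∑ k, (τ k)⁻¹ := Finset.sum_nonneg fun k _ => (inv_pos.2 (hτ k)).le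
    -- A common lower bound for the τ's that makes sense also for M = 0.
    refine ⟨(1 + ∑ k, (τ k)⁻¹)⁻¹, by positivity, inv_le_one_of_one_le₀ (by linarith),
      fun k => inv_le_of_inv_le₀ (hτ k) ?_⟩
    have := Finset.single_le_sum (f := fun k => (τ k)⁻¹)
      (fun k _ => (inv_pos.2 (hτ k)).le) (Finset.mem_univ k)
    linarith
  set P : ℕ := ∑ k, s k + 1 with hPdef
  have hP : 1 ≤ P := by omega
  have hP' : (1 : ℝ) ≤ P := by exact_mod_cast hP
  set c : ℝ := (τ₀ / (2 * Real.pi * P)) ^ P / (2 * P * 2 ^ P) with hcdef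
  have hc : 0 < c := by positivity
  have hc1 : c ≤ 1 := by
    have h1 : τ₀ / (2 * Real.pi * P) ≤ 1 :=
      (div_le_one (by positivity)).2 (by nlinarith [Real.pi_gt_three])
    have h2 : (1 : ℝ) ≤ 2 ^ P := one_le_pow₀ (by norm_num)
    exact (div_le_one (by positivity)).2
      ((pow_le_one₀ (by positivity) h1).trans (by nlinarith))
  have hcC : c ≤ 6 * P := by linarith
  -- C₁ keeps the filters short; C₂ = c/(2C) separates the levels and also gives Nh ≤ 1.
  refine ⟨4 * Real.pi * P, c / (2 * (6 * P)), c, 6 * P, by positivity, by positivity, hc,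
    by positivity, ?_⟩
  intro n x h θ N hx hnN hNθ hNh
  obtain ⟨κ, hκ, hsep⟩ := hx.exists_partition
  have hθ := hx.theta_pos
  have hN : 0 < N := by
    by_contra! h0
    obtain rfl : N = 0 := by omega
    have : 0 < 4 * Real.pi * (P : ℝ) := by positivity
    simp at hNθ
    linarith
  have hN' : (0 : ℝ) < N := by exact_mod_cast hN
  have hcard : ∀ k, Fintype.card {i : Fin n // κ i = k} = s k := fun k => (hκ k).card_eq
  have hn : ∑ k, s k = n := by
    have h1 : ∑ k, (Finset.univ.filter fun i => κ i = k).card = n := by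
      rw [← Finset.card_eq_sum_card_fiberwise (by simp), Finset.card_fin]
    rw [← h1]
    exact Finset.sum_congr rfl fun k _ => by rw [← hcard, Fintype.card_subtype]
  have hlow : ∀ i j, i ≠ j → κ i = κ j → τ (κ j) * h ≤ wrapDist (x i) (x j) :=
    fun i j hij hk => (hκ (κ j)).le_dist ⟨i, hk⟩ ⟨j, rfl⟩ (by simpa using hij)
  have hupp : ∀ i j, i ≠ j → κ i = κ j → wrapDist (x i) (x j) ≤ h :=
    fun i j hij hk => (hκ (κ j)).dist_le ⟨i, hk⟩ ⟨j, rfl⟩ (by simpa using hij)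
  suffices hmain : ∀ h' : ℝ, 0 < h' → N * h' ≤ c / (2 * (6 * P)) →
      (∀ i j, i ≠ j → κ i = κ j → τ₀ * h' ≤ wrapDist (x i) (x j)) →
      (∀ i j, i ≠ j → κ i = κ j → wrapDist (x i) (x j) ≤ h') →
      ∀ j ∈ Finset.Icc 1 (Finset.univ.sup s), ∀ i : Fin n, ∑ k, min (s k) (j - 1) ≤ i →
        i < ∑ k, min (s k) j →
        ScalesAtLevel c (6 * P) N h' j (vandermondeSingularValue N x i) by
    by_cases hpair : ∃ i j, i ≠ j ∧ κ i = κ j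
    · obtain ⟨i, j, hij, hk⟩ := hpair
      have hh0 : 0 ≤ h := (wrapDist_nonneg _ _).trans (hupp i j hij hk)
      have hh : 0 < h := (wrapDist_pos (hx.mem_Ioc i) (hx.mem_Ioc j)
        (hx.injective.ne hij)).trans_le (hupp i j hij hk)
      refine card_scalesAtLevel_of_index s hc hcC hN hh hNh _ hn
        (hmain h hh hNh (fun i j hij hk => le_trans ?_ (hlow i j hij hk)) hupp)
      exact mul_le_mul_of_nonneg_right (hττ _) hh0
    -- With singleton clusters only, h may be zero or negative. But then j = 1 is the only possible
    -- level and h enters as (Nh)^0, so any admissible positive h' may replace it.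
    · push Not at hpair
      have hs1 : ∀ k, s k ≤ 1 := by
        intro k
        rw [← hcard k, Fintype.card_le_one_iff]
        intro a b
        by_contra hab
        exact hpair a b (fun h => hab (Subtype.ext h)) (a.2.trans b.2.symm)
      have hsup : Finset.univ.sup s ≤ 1 := Finset.sup_le fun k _ => hs1 k
      set h' : ℝ := c / (2 * (6 * P)) / N with hh'def
      have hh' : 0 < h' := by positivity
      have hNh' : N * h' ≤ c / (2 * (6 * P)) := (mul_div_cancel₀ _ hN'.ne').le
      have hscale : ∀ j ∈ Finset.Icc 1 (Finset.univ.sup s), ∀ σ,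
          ScalesAtLevel c (6 * P) N h j σ ↔ ScalesAtLevel c (6 * P) N h' j σ := by
        intro j hj σ
        have hj0 : j - 1 = 0 := by have := (Finset.mem_Icc.1 hj).2; omega
        simp only [ScalesAtLevel, hj0, pow_zero]
      obtain ⟨h1, h2⟩ := card_scalesAtLevel_of_index s hc hcC hN hh' hNh' _ hn
        (hmain h' hh' hNh' (fun i j hij hk => absurd hk (hpair i j hij))
          fun i j hij hk => absurd hk (hpair i j hij))
      refine ⟨fun j hj => ?_, fun i => ?_⟩
      · simp only [hscale j hj]
        exact h1 j hj
      · refine (existsUnique_congr fun j => ?_).1 (h2 i)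
        exact and_congr_right fun hj => (hscale j hj _).symm
  intro h' hh' hNh' hlow' hupp' j hj i hi1 hi2
  have hj1 := (Finset.mem_Icc.1 hj).1
  have hNh1 : N * h' ≤ 1 := hNh'.trans ((div_le_one (by positivity)).2 (by linarith))
  have hjP : j - 1 ≤ P := by
    have h1 : Finset.univ.sup s ≤ ∑ k, s k :=
      Finset.sup_le fun k _ => Finset.single_le_sum (fun _ _ => Nat.zero_le _) (Finset.mem_univ k)
    have := (Finset.mem_Icc.1 hj).2
    omega
  constructor
  · obtain ⟨S, hScard, hS⟩ := exists_finset_card_eq_sum_min s κ hcard j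
    exact le_vandermondeSingularValue x κ hP (by omega) hjP hN hnN hτ₀ hτ₁ hh' hNh1 hθ hNθ hlow'
      hupp' hsep S (by rwa [Nat.sub_add_cancel hj1]) i (by rwa [hScard])
  · exact vandermondeSingularValue_le x κ s (by omega) hN hh' hNh1 hcard hs hupp' i hi1
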